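/- Let $E$ be the Euclidean plane and $\Phi\subset E$ the root system of type $A_2$, with simple roots $\alpha_1,\alpha_2$ satisfying $(\alpha_i,\alpha_i)=2$, $(\alpha_1,\alpha_2)=-1$. Let $\varpi_1,\varpi_2$ be the fundamental weights and $\rho=\alpha_1+\alpha_2=\varpi_1+\varpi_2$. For a root $\alpha$ and $k\in\mathbb Z$ let $s_{\alpha,k}$ be the orthogonal reflection in the line $\{v\in E\mid(\alpha,v)=k\}$. Let $W$ be the affine Weyl group of type $\widetilde A_2$, that is, the Coxeter group with generators $s_0,s_1,s_2$, every two of which satisfy a braid relation of length three. It acts on $E$ by $s_0=s_{\rho,-1}$, $s_1=s_{\alpha_1,0}$, $s_2=s_{\alpha_2,0}$. Let $\leq$ be its Bruhat order. Let $$A_+=\{v\in E\mid -1<(\alpha,v)<0\ \text{for}\ \alpha\in\{\alpha_1,\alpha_2,\rho\}\},$$ an open triangle with vertices $0,-\varpi_1,-\varpi_2$. For $z\in W$ let $\operatorname{cen}(z)$ be the center of the triangle $zA_+$. An element $x\in W$ is dominant if $xA_+$ meets the dominant chamber $\{v\mid (\alpha_1,v)>0,\ (\alpha_2,v)>0\}$.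 Consider the following six rays, where the $i$-th ray lies on the line fixed by the reflection $r_i$. The first three start at $-\varpi_1$, have directions $\varpi_2,\ \varpi_2-\varpi_1,\ -\varpi_1$, and have $r_1=s_{\alpha_1,-1}$, $r_2=s_{\rho,-1}$, $r_3=s_{\alpha_2,0}$. The last three start at $-\varpi_2$, have directions $-\varpi_2,\ \varpi_1-\varpi_2,\ \varpi_1$, and have $r_4=s_{\alpha_1,0}$, $r_5=s_{\rho,-1}$, $r_6=s_{\alpha_2,-1}$. Let $x$ be dominant. Put $x_1=\operatorname{cen}(x)$ and $x_{i+1}=r_ix_i$ for $1\leq i\leq 6$ (so that $x_7=x_1$). The segment $\overline{x_ix_{i+1}}$ cuts the $i$-th ray into a bounded and an unbounded part. Let $u_{i+1}$ be the point in the unbounded part for which $x_i,u_{i+1},x_{i+1}$ is an equilateral triangle. The twelve segments $\overline{x_iu_{i+1}}$ and $\overline{u_{i+1}x_{i+1}}$, $1\leq i\leq 6$, form a closed curve. Let $\mathcal{St}(x)$ be the star-shaped polygon consisting of this curve and the region it encloses, and let $\mathcal{St}^\circ(x)$ be its interior. Proposition. If $x\in W$ is dominant, then $$\{z\in W\mid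 z\geq x\}=\{z\in W\mid \operatorname{cen}(z)\notin\mathcal{St}^\circ(x)\}.$$ -/

import Mathlib

noncomputable section

namespace AffineA2

/-! ### The Coxeter system of type `Ã₂` and its Bruhat order -/

/-- The Coxeter matrix of type `Ã₂`: every two distinct generators satisfy a braid relation of
length three. -/
def coxeterMatrix : CoxeterMatrix (Fin 3) where
  M := fun i j => if i = j then 1 else 3
  isSymm := by ext i j; simp only [Matrix.transpose, Matrix.of_apply, eq_comm]
  diagonal := by intro i; simp
  off_diagonal := by intro i j h; simp [h]

/-- The affine Weyl group `W` of type `Ã₂`, generated by `s₀, s₁, s₂`. -/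
abbrev W : Type := coxeterMatrix.Group

/-- `W` with its Coxeter generators `s₀, s₁, s₂`. -/
abbrev cs : CoxeterSystem coxeterMatrix W := coxeterMatrix.toCoxeterSystem

/-- The Bruhat order: the reflexive transitive closure of `u → u t`, where `t` is a reflection
and `ℓ u < ℓ (u t)`. -/
def BruhatLE : W → W → Prop :=
  Relation.ReflTransGen fun u v => ∃ t, cs.IsReflection t ∧ v = u * t ∧ cs.length u < cs.length v

/-- The upper set `≥ x`. -/
def upperSet (x : W) : Set W := {z | BruhatLE x z}

/-! ### The root system of type `A₂` and the action of `W` on the plane -/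

/-- The Euclidean plane. -/
abbrev E : Type := EuclideanSpace ℝ (Fin 2)

/-- The simple root `α₁`, of squared length two. -/
def α₁ : E := !₂[-(√6 / 2), √2 / 2]

/-- The simple root `α₂`, of squared length two, at an angle of `2π/3` with `α₁`. -/
def α₂ : E := !₂[√6 / 2, √2 / 2]

/-- The highest root `ρ = α₁ + α₂ = ϖ₁ + ϖ₂`. -/
def ρ : E := α₁ + α₂

/-- The fundamental weight `ϖ₁`. -/
def ϖ₁ : E := (3⁻¹ : ℝ) • ((2 : ℝ) • α₁ + α₂)

/-- The fundamental weight `ϖ₂`. -/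
def ϖ₂ : E := (3⁻¹ : ℝ) • (α₁ + (2 : ℝ) • α₂)

theorem inner_α₁_α₁ : inner ℝ α₁ α₁ = 2 := by
  have h6 := Real.mul_self_sqrt (show (0 : ℝ) ≤ 6 by norm_num)
  have h2 := Real.mul_self_sqrt (show (0 : ℝ) ≤ 2 by norm_num)
  simp only [α₁, PiLp.inner_apply, Fin.sum_univ_two]
  simp [div_pow, sq_abs]
  nlinarith

theorem inner_α₂_α₂ : inner ℝ α₂ α₂ = 2 := by
  have h6 := Real.mul_self_sqrt (show (0 : ℝ) ≤ 6 by norm_num)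
  have h2 := Real.mul_self_sqrt (show (0 : ℝ) ≤ 2 by norm_num)
  simp only [α₂, PiLp.inner_apply, Fin.sum_univ_two]
  simp [div_pow, sq_abs]
  nlinarith

theorem inner_α₁_α₂ : inner ℝ α₁ α₂ = -1 := by
  have h6 := Real.mul_self_sqrt (show (0 : ℝ) ≤ 6 by norm_num)
  have h2 := Real.mul_self_sqrt (show (0 : ℝ) ≤ 2 by norm_num)
  simp [α₁, α₂, PiLp.inner_apply, Fin.sum_univ_two]
  nlinarith

theorem inner_α₂_α₁ : inner ℝ α₂ α₁ = -1 := by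
  rw [real_inner_comm, inner_α₁_α₂]

theorem reflection_involutive (α : E) (k : ℝ) :
    Function.Involutive fun v : E => v - (2 * (inner ℝ α v - k) / inner ℝ α α) • α := by
  intro v
  by_cases h : inner ℝ α α = 0
  · have h0 : α = 0 := inner_self_eq_zero.mp h
    simp [h0]
  · simp only [inner_sub_right, inner_smul_right]
    match_scalars
    · ring
    · field_simp
      ring

/-- The orthogonal reflection `s_{α,k}` in the affine line `{v | (α, v) = k}`, for `α ≠ 0`. -/
def affineReflection (α : E) (k : ℝ) : Equiv.Perm E :=
  (reflection_involutive α k).toPerm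

theorem affineReflection_apply (α : E) (k : ℝ) (v : E) :
    affineReflection α k v = v - (2 * (inner ℝ α v - k) / inner ℝ α α) • α := rfl

/-- The reflections by which `s₀, s₁, s₂` act: `s₀ = s_{ρ,-1}`, `s₁ = s_{α₁,0}`,
`s₂ = s_{α₂,0}`. -/
def simpleReflection : Fin 3 → Equiv.Perm E :=
  ![affineReflection ρ (-1), affineReflection α₁ 0, affineReflection α₂ 0]

theorem affineReflection_mul_self (α : E) (k : ℝ) :
    affineReflection α k * affineReflection α k = 1 := by
  ext1 v
  exact reflection_involutive α k v

theorem affineReflection_braid {α β : E} {c : ℝ} (k l : ℝ) (hα : inner ℝ α α = 2)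
    (hβ : inner ℝ β β = 2) (hαβ : inner ℝ α β = c) (hc : c = 1 ∨ c = -1) :
    (affineReflection α k * affineReflection β l) ^ 3 = 1 := by
  have hβα : inner ℝ β α = c := by rw [real_inner_comm, hαβ]
  ext1 v
  simp only [pow_succ, pow_zero, one_mul, Equiv.Perm.mul_apply, affineReflection_apply,
    inner_sub_right, inner_smul_right, hα, hβ, hαβ, hβα, Equiv.Perm.coe_one, id]
  rcases hc with rfl | rfl <;> (match_scalars <;> ring)

theorem simpleReflection_isLiftable : coxeterMatrix.IsLiftable simpleReflection := by
  have hρ : inner ℝ ρ ρ = 2 := by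
    simp only [ρ, inner_add_left, inner_add_right, inner_α₁_α₁, inner_α₂_α₂, inner_α₁_α₂,
      inner_α₂_α₁]
    norm_num
  have h1 : inner ℝ ρ α₁ = 1 := by
    simp only [ρ, inner_add_left, inner_α₁_α₁, inner_α₂_α₁]
    norm_num
  have h2 : inner ℝ ρ α₂ = 1 := by
    simp only [ρ, inner_add_left, inner_α₁_α₂, inner_α₂_α₂]
    norm_num
  have h1' : inner ℝ α₁ ρ = 1 := by rw [real_inner_comm, h1]
  have h2' : inner ℝ α₂ ρ = 1 := by rw [real_inner_comm, h2]
  have hM : ∀ i j : Fin 3, coxeterMatrix i j = if i = j then 1 else 3 := fun _ _ => rfl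
  intro i j
  rw [hM]
  fin_cases i <;> fin_cases j
  · simpa [simpleReflection] using affineReflection_mul_self ρ (-1)
  · exact affineReflection_braid _ _ hρ inner_α₁_α₁ h1 (Or.inl rfl)
  · exact affineReflection_braid _ _ hρ inner_α₂_α₂ h2 (Or.inl rfl)
  · exact affineReflection_braid _ _ inner_α₁_α₁ hρ h1' (Or.inl rfl)
  · simpa [simpleReflection] using affineReflection_mul_self α₁ 0
  · exact affineReflection_braid _ _ inner_α₁_α₁ inner_α₂_α₂ inner_α₁_α₂ (Or.inr rfl)
  · exact affineReflection_braid _ _ inner_α₂_α₂ hρ h2' (Or.inl rfl)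
  · exact affineReflection_braid _ _ inner_α₂_α₂ inner_α₁_α₁ inner_α₂_α₁ (Or.inr rfl)
  · simpa [simpleReflection] using affineReflection_mul_self α₂ 0

/-- The action of `W` on the plane, in which `sᵢ` acts as `simpleReflection i`. -/
def act : W →* Equiv.Perm E := cs.lift ⟨simpleReflection, simpleReflection_isLiftable⟩

/-! ### Alcoves, centers, dominant elements -/

/-- The fundamental alcove `A₊`: the points with `-1 < (α, v) < 0` for every positive root `α`. -/
def fundamentalAlcove : Set E :=
  {v | ∀ α ∈ ({α₁, α₂, ρ} : Set E), -1 < inner ℝ α v ∧ inner ℝ α v < 0}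

/-- The alcove `z A₊`. -/
def alcove (z : W) : Set E := act z '' fundamentalAlcove

/-- The center of the alcove `z A₊`, a triangle whose vertices are the images under `z` of the
vertices `0, -ϖ₁, -ϖ₂` of `A₊`. -/
def cen (z : W) : E := (3⁻¹ : ℝ) • (act z 0 + act z (-ϖ₁) + act z (-ϖ₂))

/-- The (open) dominant chamber. -/
def dominantChamber : Set E := {v | 0 < inner ℝ α₁ v ∧ 0 < inner ℝ α₂ v}

/-- An element is dominant if its alcove meets the dominant chamber. -/
def IsDominant (x : W) : Prop := (alcove x ∩ dominantChamber).Nonempty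

/-! ### The star-shaped polygon

The plane is divided into six zones by three rays starting at the vertex `-ϖ₁` of `A₊` and three
rays starting at the vertex `-ϖ₂`, together with the side of `A₊` between these two vertices.
The rays are numbered clockwise, beginning at the boundary of the zone of the dominant chamber. -/

/-- The affine reflection in the line that contains the `i`-th ray. -/
def rayReflection : Fin 6 → Equiv.Perm E :=
  ![affineReflection α₁ (-1), affineReflection ρ (-1), affineReflection α₂ 0,
    affineReflection α₁ 0, affineReflection ρ (-1), affineReflection α₂ (-1)]

/-- The direction of the `i`-th ray; the first three rays start at `-ϖ₁`, the last three
at `-ϖ₂`. -/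
def rayDirection : Fin 6 → E := ![ϖ₂, ϖ₂ - ϖ₁, -ϖ₁, -ϖ₂, ϖ₁ - ϖ₂, ϖ₁]

/-- The inner vertices of the star: the center of `x`, then successively reflected in the lines
of the rays (with the rays numbered modulo six). -/
def innerVertex (x : W) : ℕ → E
  | 0 => cen x
  | n + 1 => rayReflection (Fin.ofNat 6 n) (innerVertex x n)

/-- The outer vertex of the star on the `i`-th ray: the apex of the equilateral triangle whose
base is the segment from the `i`-th inner vertex to the next one. The `i`-th ray is perpendicular
to this base and crosses it at its midpoint; the apex lies on the ray, beyond the midpoint,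
at a distance of `√3 / 2` times the length of the base. -/
def outerVertex (x : W) (i : Fin 6) : E :=
  midpoint ℝ (innerVertex x i.val) (innerVertex x (i.val + 1)) +
    (√3 / 2 * dist (innerVertex x i.val) (innerVertex x (i.val + 1)) / ‖rayDirection i‖) •
      rayDirection i

/-- The closed polygonal curve bounding the star. -/
def starBoundary (x : W) : Set E :=
  ⋃ i : Fin 6, (segment ℝ (innerVertex x i.val) (outerVertex x i) ∪
    segment ℝ (outerVertex x i) (innerVertex x (i.val + 1)))

/-- The star-shaped polygon: the bounding curve together with the region that it encloses, that is,
the points lying in a bounded connected component of the complement of the curve. -/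
def starPolygon (x : W) : Set E :=
  starBoundary x ∪
    {v | v ∈ (starBoundary x)ᶜ ∧ Bornology.IsBounded (connectedComponentIn (starBoundary x)ᶜ v)}

end AffineA2

end

namespace AffineA2

/-! ### The action of `W` on a lattice containing the centers of the alcoves -/

/-! For dominant x the star is the union of two equilateral triangles, centred at the vertices `-ϖ₁`
and `-ϖ₂` of `A₊`. They are the sublevel sets through cen(x) of two convex functions, `gauge₁` and
`gauge₂`. The i-th one is a maximum of affine functionals whose linear parts form the finite Weyl
group orbit of ϖᵢ, and it is invariant under the reflections fixing -ϖᵢ. The outer vertices of the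
star are alternately corners of the two triangles. So the theorem says that z ≥ x exactly when both
functions are at least as large at cen(z) as at cen(x).

Necessity (`height_le_of_bruhatLE`): by `val_mul_val_pos_of_length_lt`, a length-raising reflection
moves an alcove away from `A₊` across its line. Such a move does not decrease either function
(`height_le_height_reflect`).

Sufficiency (`bruhatLE_of_height_le`): if z ≠ x satisfies both inequalities, some reflection
shortens z and preserves the inequalities (`exists_root_reflect_height_le`). Induction on length
then leads down to x.

The Bruhat half uses integer arithmetic on centers, with `height₁` and `height₂` equal to nine times
the gauges. The geometric half identifies the interior of the star with the union of the two open
triangles (`interior_starPolygon_eq`). -/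

/-- An affine root `v ↦ m (α₁, v) + n (α₂, v) + k`. -/
@[ext] structure AffineRoot where
  m : ℤ
  n : ℤ
  k : ℤ
  isRoot : (m = 1 ∧ n = 0) ∨ (m = 0 ∧ n = 1) ∨ (m = 1 ∧ n = 1) ∨
    (m = -1 ∧ n = 0) ∨ (m = 0 ∧ n = -1) ∨ (m = -1 ∧ n = -1)

namespace AffineRoot

/-- Three times the value of an affine root at the point `v` with
`(α₁, v) = p.1 / 3` and `(α₂, v) = p.2 / 3`. -/
def val (r : AffineRoot) (p : ℤ × ℤ) : ℤ := r.m * p.1 + r.n * p.2 + 3 * r.k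

theorem reflect_involutive (r : AffineRoot) : Function.Involutive fun p : ℤ × ℤ =>
    (p.1 - r.val p * (2 * r.m - r.n), p.2 - r.val p * (2 * r.n - r.m)) := by
  obtain ⟨m, n, k, h⟩ := r
  rintro ⟨P, Q⟩
  rcases h with h | h | h | h | h | h <;> obtain ⟨rfl, rfl⟩ := h <;>
    ext <;> simp only [val] <;> ring

/-- The reflection in the line on which an affine root vanishes. -/
def reflect (r : AffineRoot) : Equiv.Perm (ℤ × ℤ) := r.reflect_involutive.toPerm

theorem reflect_apply (r : AffineRoot) (p : ℤ × ℤ) : r.reflect p =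
    (p.1 - r.val p * (2 * r.m - r.n), p.2 - r.val p * (2 * r.n - r.m)) := rfl

/-- The opposite affine root. -/
def neg (r : AffineRoot) : AffineRoot := ⟨-r.m, -r.n, -r.k, by have := r.isRoot; omega⟩

theorem val_neg (r : AffineRoot) (p : ℤ × ℤ) : r.neg.val p = -r.val p := by
  simp only [neg, val]; ring

theorem reflect_neg (r : AffineRoot) (p : ℤ × ℤ) : r.neg.reflect p = r.reflect p := by
  ext <;> simp only [reflect_apply, val_neg] <;> simp only [neg] <;> ring

/-- The affine roots that vanish on the sides of `A₊` and are positive on `A₊`. -/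
def simple : Fin 3 → AffineRoot :=
  ![⟨1, 1, 1, by decide⟩, ⟨-1, 0, 0, by decide⟩, ⟨0, -1, 0, by decide⟩]

/-- The composition of an affine root with a simple reflection. -/
def compSimple (r : AffineRoot) (i : Fin 3) : AffineRoot where
  m := r.m - (r.m * (2 * (simple i).m - (simple i).n) +
    r.n * (2 * (simple i).n - (simple i).m)) * (simple i).m
  n := r.n - (r.m * (2 * (simple i).m - (simple i).n) +
    r.n * (2 * (simple i).n - (simple i).m)) * (simple i).n
  k := r.k - (r.m * (2 * (simple i).m - (simple i).n) +
    r.n * (2 * (simple i).n - (simple i).m)) * (simple i).k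
  isRoot := by
    have h := r.isRoot
    fin_cases i <;> simp [simple] <;> omega

theorem val_compSimple (r : AffineRoot) (i : Fin 3) (p : ℤ × ℤ) :
    (r.compSimple i).val p = r.val ((simple i).reflect p) := by
  simp only [compSimple, val, reflect_apply]; ring

theorem reflect_compSimple (r : AffineRoot) (i : Fin 3) (p : ℤ × ℤ) :
    r.reflect ((simple i).reflect p) = (simple i).reflect ((r.compSimple i).reflect p) := by
  obtain ⟨m, n, k, h⟩ := r
  fin_cases i <;> rcases h with h | h | h | h | h | h <;> obtain ⟨rfl, rfl⟩ := h <;>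
    ext <;> simp [compSimple, simple, val, reflect_apply] <;> ring

theorem simple_isLiftable : coxeterMatrix.IsLiftable fun i => (simple i).reflect := by
  have hM : ∀ i j : Fin 3, coxeterMatrix i j = if i = j then 1 else 3 := fun _ _ => rfl
  intro i j
  rw [hM]
  ext1 ⟨P, Q⟩
  fin_cases i <;> fin_cases j <;>
    simp [pow_succ, Equiv.Perm.mul_apply, reflect_apply, simple, val] <;>
    constructor <;> ring

end AffineRoot

open AffineRoot

/-- The action of `W` on the points `v`, given by the pairs `(3 (α₁, v), 3 (α₂, v))`. -/
def latticeAct : W →* Equiv.Perm (ℤ × ℤ) := cs.lift ⟨_, simple_isLiftable⟩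

theorem latticeAct_simple (i : Fin 3) : latticeAct (cs.simple i) = (simple i).reflect :=
  cs.lift_apply_simple simple_isLiftable i

theorem latticeAct_mul (u v : W) (p : ℤ × ℤ) :
    latticeAct (u * v) p = latticeAct u (latticeAct v p) := by
  rw [map_mul, Equiv.Perm.mul_apply]

theorem latticeAct_one (p : ℤ × ℤ) : latticeAct 1 p = p := by simp

/-- Three times the coordinates `(α₁, v)`, `(α₂, v)` of the center `v` of `z A₊`. -/
def center (z : W) : ℤ × ℤ := latticeAct z (-1, -1)

theorem center_one : center 1 = (-1, -1) := latticeAct_one _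

theorem center_mul (u v : W) : center (u * v) = latticeAct u (center v) := latticeAct_mul u v _

/-- The pullback of an affine root along `w`, together with the fact that `w` conjugates the two
reflections. It lets questions about an arbitrary alcove be settled at `A₊`. -/
theorem exists_root_comp (w : W) : ∀ r : AffineRoot, ∃ r' : AffineRoot,
    (∀ p, r'.val p = r.val (latticeAct w p)) ∧
      ∀ p, r.reflect (latticeAct w p) = latticeAct w (r'.reflect p) := by
  refine cs.simple_induction_right (p := fun w => ∀ r : AffineRoot, ∃ r' : AffineRoot,
    (∀ p, r'.val p = r.val (latticeAct w p)) ∧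
      ∀ p, r.reflect (latticeAct w p) = latticeAct w (r'.reflect p)) w
    (fun r => ⟨r, by simp, by simp⟩) ?_
  intro w i ih r
  obtain ⟨r₁, h₁, h₂⟩ := ih r
  refine ⟨r₁.compSimple i, fun p => ?_, fun p => ?_⟩
  · rw [latticeAct_mul, latticeAct_simple, ← h₁, val_compSimple]
  · rw [latticeAct_mul, latticeAct_simple, h₂, reflect_compSimple, latticeAct_mul,
      latticeAct_simple]

theorem exists_root_of_isReflection {t : W} (ht : cs.IsReflection t) :
    ∃ r : AffineRoot, ∀ p, latticeAct t p = r.reflect p := by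
  obtain ⟨w, i, rfl⟩ := ht
  obtain ⟨r, -, h⟩ := exists_root_comp w⁻¹ (simple i)
  refine ⟨r, fun p => ?_⟩
  rw [mul_assoc, latticeAct_mul, latticeAct_mul, latticeAct_simple, h, ← latticeAct_mul]
  simp

/-- This congruence keeps centers off all reflection lines, and it also drives the arithmetic of the
descent. -/
theorem center_mod_three (z : W) : (center z).1 % 3 = (center z).2 % 3 ∧ (center z).1 % 3 ≠ 0 := by
  refine cs.simple_induction_left (p := fun z => (center z).1 % 3 = (center z).2 % 3 ∧
    (center z).1 % 3 ≠ 0) z (by rw [center_one]; decide) ?_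
  intro w i ih
  rw [center_mul, latticeAct_simple]
  generalize center w = p at *
  fin_cases i <;> simp [simple, val, reflect_apply] <;> omega

theorem val_center_ne_zero (r : AffineRoot) (z : W) : r.val (center z) ≠ 0 := by
  have h := center_mod_three z
  obtain ⟨m, n, k, hr⟩ := r
  rcases hr with hr | hr | hr | hr | hr | hr <;> obtain ⟨rfl, rfl⟩ := hr <;>
    simp only [val] <;> omega

/-! ### Lengths and the sides of the lines -/

/-- The classical link between descents and walls, by reduction to the rank two subgroup generated
by `i` and a right descent `j` of `w`. It rests on αᵢ∘sⱼ = αᵢ + αⱼ and αᵢ∘sⱼ∘sᵢ = αⱼ for distinct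
simple affine roots. -/
theorem simple_val_center_inv_pos (w : W) : ∀ i : Fin 3,
    cs.length w < cs.length (w * cs.simple i) → 0 < (simple i).val (center w⁻¹) := by
  induction hn : cs.length w using Nat.strong_induction_on generalizing w with
  | _ n ih =>
  subst hn
  intro i hi
  by_cases hw : w = 1
  · subst hw
    rw [inv_one, center_one]
    fin_cases i <;> decide
  obtain ⟨j, hj⟩ := cs.exists_rightDescent_of_ne_one hw
  have hj' : cs.length (w * cs.simple j) < cs.length w := hj
  have hij : i ≠ j := by rintro rfl; omega
  have hbraid : cs.simple j * cs.simple i * cs.simple j =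
      cs.simple i * cs.simple j * cs.simple i := by
    have h := cs.simple_mul_simple_pow i j
    have hM : coxeterMatrix i j = 3 := if_neg hij
    rw [hM, pow_succ, pow_two] at h
    have h' := eq_inv_of_mul_eq_one_left h
    calc cs.simple j * cs.simple i * cs.simple j
        = cs.simple i * (cs.simple i * cs.simple j * (cs.simple i * cs.simple j)) := by
          simp [-CoxeterMatrix.toCoxeterSystem_simple, mul_assoc]
      _ = _ := by simp [-CoxeterMatrix.toCoxeterSystem_simple, h', mul_assoc]
  have hsum : ∀ p, (simple i).val ((simple j).reflect p) =
      (simple i).val p + (simple j).val p := by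
    intro p
    fin_cases i <;> fin_cases j <;> simp [simple, val, reflect_apply] at hij ⊢ <;> ring
  have hswap : ∀ p, (simple i).val ((simple j).reflect ((simple i).reflect p)) =
      (simple j).val p := by
    intro p
    fin_cases i <;> fin_cases j <;> simp [simple, val, reflect_apply] at hij ⊢ <;> ring
  have hwj : w = w * cs.simple j * cs.simple j := (cs.simple_mul_simple_cancel_right j).symm
  by_cases h : cs.length (w * cs.simple j) < cs.length (w * cs.simple j * cs.simple i)
  · have h₁ := ih _ hj' (w * cs.simple j) rfl i h
    have h₂ := ih _ hj' (w * cs.simple j) rfl j (by rwa [← hwj])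
    have h₃ : center w⁻¹ = (simple j).reflect (center (w * cs.simple j)⁻¹) := by
      rw [← latticeAct_simple, ← center_mul]; simp
    rw [h₃, hsum]
    omega
  · have hd₁ := cs.length_mul_simple w j
    have hd₂ := cs.length_mul_simple (w * cs.simple j) i
    have h₃ : center w⁻¹ = (simple j).reflect ((simple i).reflect
        (center (w * cs.simple j * cs.simple i)⁻¹)) := by
      rw [← latticeAct_simple, ← latticeAct_simple, ← center_mul, ← center_mul]
      simp [mul_assoc]
    rw [h₃, hswap]
    refine ih _ (by omega) _ rfl j ?_
    -- Otherwise `w = w' sⱼsᵢsⱼ` with `w'` shorter by three, so that `w sᵢ = w' sᵢsⱼ` has length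
    -- below that of `w`, against `hi`.
    by_contra hcon
    have hd₃ := cs.length_mul_simple (w * cs.simple j * cs.simple i) j
    have hws : w * cs.simple i =
        w * cs.simple j * cs.simple i * cs.simple j * cs.simple i * cs.simple j := by
      have : w * cs.simple j * cs.simple i * cs.simple j * cs.simple i * cs.simple j =
          w * (cs.simple j * cs.simple i * cs.simple j) * cs.simple i * cs.simple j := by
        simp only [mul_assoc]
      rw [this, hbraid]
      simp [-CoxeterMatrix.toCoxeterSystem_simple, mul_assoc]
    have hd₄ := cs.length_mul_simple
      (w * cs.simple j * cs.simple i * cs.simple j) i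
    have hd₅ := cs.length_mul_simple
      (w * cs.simple j * cs.simple i * cs.simple j * cs.simple i) j
    rw [← hws] at hd₅
    omega

/-- W acts freely on alcoves: for a right descent `i` of a nontrivial `w` fixing the center of `A₊`,
the previous lemma would put `sᵢA₊` on the same side of the i-th wall as `A₊`. -/
theorem center_injective : Function.Injective center := by
  have key : ∀ w : W, center w = (-1, -1) → w = 1 := by
    intro w hw
    by_contra h
    obtain ⟨i, hi⟩ := cs.exists_rightDescent_of_ne_one h
    have hi' : cs.length (w * cs.simple i) < cs.length w := hi
    have h₁ := simple_val_center_inv_pos (w * cs.simple i) i 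
      (by rwa [cs.simple_mul_simple_cancel_right])
    have h₂ : center w⁻¹ = (-1, -1) := by
      have h := center_mul w⁻¹ w
      rw [inv_mul_cancel, hw, center_one] at h
      exact h.symm
    have h₃ : center (w * cs.simple i)⁻¹ = (simple i).reflect (-1, -1) := by
      rw [mul_inv_rev, center_mul, h₂, cs.inv_simple, latticeAct_simple]
    rw [h₃] at h₁
    revert h₁
    fin_cases i <;> decide
  intro u v huv
  have h : center (v⁻¹ * u) = (-1, -1) := by
    rw [center_mul, huv, ← center_mul, inv_mul_cancel, center_one]
  exact (inv_mul_eq_one.mp (key _ h)).symm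

/-- Strong exchange in geometric form. Removing a right descent moves `u` to a neighbouring alcove.
Either that alcove is still beyond the line and induction applies, or the line is the common wall of
the two alcoves and `t` interchanges them. -/
theorem length_reflection_mul_lt (t : W) (r : AffineRoot)
    (ht : ∀ p, latticeAct t p = r.reflect p) (h₁ : 0 < r.val (-1, -1)) (u : W)
    (h₂ : r.val (center u) < 0) : cs.length (t * u) < cs.length u := by
  induction hn : cs.length u using Nat.strong_induction_on generalizing u with
  | _ n ih =>
  subst hn
  by_cases hu : u = 1
  · subst hu
    rw [center_one] at h₂
    omega
  obtain ⟨i, hi⟩ := cs.exists_rightDescent_of_ne_one hu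
  have hi' : cs.length (u * cs.simple i) < cs.length u := hi
  have hui : u = u * cs.simple i * cs.simple i := (cs.simple_mul_simple_cancel_right i).symm
  rcases lt_or_gt_of_ne (val_center_ne_zero r (u * cs.simple i)) with h | h
  · have h₃ := ih _ hi' (u * cs.simple i) h rfl
    have h₄ := cs.length_mul_simple (t * (u * cs.simple i)) i
    rw [mul_assoc, ← hui] at h₄
    omega
  · obtain ⟨r', h₃, h₄⟩ := exists_root_comp (u * cs.simple i) r
    have h₅ : 0 < r'.val (-1, -1) := by rw [h₃]; exact h
    have h₆ : r'.val ((simple i).reflect (-1, -1)) < 0 := by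
      rw [h₃, ← latticeAct_simple, ← latticeAct_mul, ← hui]; exact h₂
    -- Pulled back to `A₊`, the root separates `A₊` from its neighbour across the i-th wall; only
    -- the simple root of that wall does so.
    have h₇ : r' = simple i := by
      obtain ⟨m, n, k, hr⟩ := r'
      rcases hr with hr | hr | hr | hr | hr | hr <;> obtain ⟨rfl, rfl⟩ := hr <;>
        fin_cases i <;> simp [simple, val, reflect_apply] at h₅ h₆ ⊢ <;> omega
    have h₈ : t * u = u * cs.simple i := by
      apply center_injective
      rw [center_mul, ht]
      conv_lhs => rw [hui]
      rw [center_mul (u * cs.simple i), h₄, h₇, ← latticeAct_simple, center,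
        ← latticeAct_mul (cs.simple i), cs.simple_mul_simple_self, latticeAct_one]
      rfl
    rwa [h₈]

/-- Left multiplication by a reflection raises the length unless the line of the
reflection separates the two alcoves. -/
theorem val_mul_val_pos_of_length_lt (t : W) (r : AffineRoot)
    (ht : ∀ p, latticeAct t p = r.reflect p) (u : W) (h : cs.length u < cs.length (t * u)) :
    0 < r.val (-1, -1) * r.val (center u) := by
  have h₁ := val_center_ne_zero r 1
  have h₂ := val_center_ne_zero r u
  rw [center_one] at h₁
  rcases lt_or_gt_of_ne h₁ with h₁ | h₁ <;> rcases lt_or_gt_of_ne h₂ with h₂ | h₂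
  · exact mul_pos_of_neg_of_neg h₁ h₂
  · have := length_reflection_mul_lt t r.neg (fun p => by rw [ht, reflect_neg])
      (by rw [val_neg]; omega) u (by rw [val_neg]; omega)
    omega
  · have := length_reflection_mul_lt t r ht h₁ u h₂
    omega
  · exact mul_pos h₁ h₂

/-! ### The Bruhat order above a dominant element -/

/-- Nine times the maximum of the linear functionals in the orbit of `ϖ₁`, based at `-ϖ₁`. -/
def height₁ (p : ℤ × ℤ) : ℤ :=
  max (2 * p.1 + p.2) (max (p.2 - p.1 - 9) (-p.1 - 2 * p.2 - 9))

/-- Nine times the maximum of the linear functionals in the orbit of `ϖ₂`, based at `-ϖ₂`. -/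
def height₂ (p : ℤ × ℤ) : ℤ :=
  max (p.1 + 2 * p.2) (max (p.1 - p.2 - 9) (-2 * p.1 - p.2 - 9))

/-- Each function is convex and invariant under the reflections in the lines through its base
vertex. No line strictly separates that vertex from `A₊`. So a point on the side of `A₊` lies
between its mirror image and the reflection of that image in the parallel line through the vertex,
two points where the function agrees. -/
theorem height_le_height_reflect (r : AffineRoot) (p : ℤ × ℤ)
    (h : 0 < r.val (-1, -1) * r.val p) :
    height₁ p ≤ height₁ (r.reflect p) ∧ height₂ p ≤ height₂ (r.reflect p) := by
  obtain ⟨m, n, k, hr⟩ := r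
  rcases pos_and_pos_or_neg_and_neg_of_mul_pos h with ⟨h₁, h₂⟩ | ⟨h₁, h₂⟩ <;>
  rcases hr with hr | hr | hr | hr | hr | hr <;> obtain ⟨rfl, rfl⟩ := hr <;>
    simp only [height₁, height₂, reflect_apply, val] at h₁ h₂ ⊢ <;> constructor <;> omega

theorem height_le_of_bruhatLE {u v : W} (h : BruhatLE u v) :
    height₁ (center u) ≤ height₁ (center v) ∧ height₂ (center u) ≤ height₂ (center v) := by
  induction h with
  | refl => exact ⟨le_rfl, le_rfl⟩
  | @tail v w _ h ih =>
    obtain ⟨t, ht, rfl, hl⟩ := h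
    obtain ⟨r, hr⟩ := exists_root_of_isReflection (ht.conj v)
    -- A reflection on the right becomes a conjugate reflection on the left, where it acts on the
    -- plane.
    have hv : v * t = v * t * v⁻¹ * v := by simp
    have h₁ := val_mul_val_pos_of_length_lt (v * t * v⁻¹) r hr v (by rwa [← hv])
    have h₂ := height_le_height_reflect r _ h₁
    rw [← hr, ← center_mul, ← hv] at h₂
    exact ⟨ih.1.trans h₂.1, ih.2.trans h₂.2⟩

/-- An element of `W` that acts as the translation by `-ρ`. -/
def translation : W := cs.simple 0 * (cs.simple 1 * cs.simple 2 * cs.simple 1)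

theorem latticeAct_translation_zpow (j : ℤ) : ∀ p : ℤ × ℤ,
    latticeAct (translation ^ j) p = (p.1 - 3 * j, p.2 - 3 * j) := by
  have h : ∀ p : ℤ × ℤ, latticeAct translation p = (p.1 - 3, p.2 - 3) := by
    intro p
    simp only [translation, latticeAct_mul, latticeAct_simple]
    ext <;> simp [reflect_apply, simple, val] <;> ring
  have h' : ∀ p : ℤ × ℤ, latticeAct translation⁻¹ p = (p.1 + 3, p.2 + 3) := by
    intro p
    rw [map_inv, Equiv.Perm.inv_eq_iff_eq, h]
    simp
  induction j using Int.induction_on with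
  | zero => simp
  | succ i ih => intro p; rw [zpow_add_one, latticeAct_mul, h, ih]; ext <;> dsimp only <;> ring
  | pred i ih => intro p; rw [zpow_sub_one, latticeAct_mul, h', ih]; ext <;> dsimp only <;> ring

/-- Translation by ρ moves lines orthogonal to a simple root by one step, so conjugates of `s₁` and
`s₂` give all of them. Lines orthogonal to ρ move by two steps, which requires one representative
for each parity. -/
theorem exists_isReflection_of_root (r : AffineRoot) :
    ∃ t, cs.IsReflection t ∧ ∀ p, latticeAct t p = r.reflect p := by
  have key : ∀ (g : W) (j : ℤ) (p : ℤ × ℤ),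
      latticeAct (translation ^ j * g * (translation ^ j)⁻¹) p =
        ((latticeAct g (p.1 + 3 * j, p.2 + 3 * j)).1 - 3 * j,
          (latticeAct g (p.1 + 3 * j, p.2 + 3 * j)).2 - 3 * j) := by
    intro g j p
    rw [latticeAct_mul, latticeAct_mul, ← zpow_neg, latticeAct_translation_zpow,
      latticeAct_translation_zpow]
    simp
  have hs := fun i : Fin 3 => cs.isReflection_simple i
  have hneg : ∀ r : AffineRoot, (∃ t, cs.IsReflection t ∧ ∀ p, latticeAct t p = r.reflect p) →
      ∃ t, cs.IsReflection t ∧ ∀ p, latticeAct t p = r.neg.reflect p := by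
    rintro r ⟨t, h₁, h₂⟩
    exact ⟨t, h₁, fun p => by rw [h₂, reflect_neg]⟩
  have h₁ : ∀ k h, ∃ t, cs.IsReflection t ∧
      ∀ p, latticeAct t p = (⟨1, 0, k, h⟩ : AffineRoot).reflect p := by
    refine fun k h => ⟨_, (hs 1).conj (translation ^ k), fun p => ?_⟩
    rw [key, latticeAct_simple]
    ext <;> simp [reflect_apply, simple, val] <;> ring
  have h₂ : ∀ k h, ∃ t, cs.IsReflection t ∧
      ∀ p, latticeAct t p = (⟨0, 1, k, h⟩ : AffineRoot).reflect p := by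
    refine fun k h => ⟨_, (hs 2).conj (translation ^ k), fun p => ?_⟩
    rw [key, latticeAct_simple]
    ext <;> simp [reflect_apply, simple, val] <;> ring
  have h₃ : ∀ k h, ∃ t, cs.IsReflection t ∧
      ∀ p, latticeAct t p = (⟨1, 1, k, h⟩ : AffineRoot).reflect p := by
    intro k h
    rcases Int.even_or_odd' k with ⟨j, rfl | rfl⟩
    · refine ⟨_, ((hs 2).conj (cs.simple 1)).conj (translation ^ j), fun p => ?_⟩
      rw [key, latticeAct_mul, latticeAct_mul, cs.inv_simple, latticeAct_simple,
        latticeAct_simple]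
      ext <;> simp [reflect_apply, simple, val] <;> ring
    · refine ⟨_, (hs 0).conj (translation ^ j), fun p => ?_⟩
      rw [key, latticeAct_simple]
      ext <;> simp [reflect_apply, simple, val] <;> ring
  obtain ⟨m, n, k, hr⟩ := r
  have hr' := hr
  rcases hr' with hr' | hr' | hr' | hr' | hr' | hr' <;> obtain ⟨rfl, rfl⟩ := hr'
  · exact h₁ k hr
  · exact h₂ k hr
  · exact h₃ k hr
  · simpa [neg] using hneg _ (h₁ (-k) (by decide))
  · simpa [neg] using hneg _ (h₂ (-k) (by decide))
  · simpa [neg] using hneg _ (h₃ (-k) (by decide))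

/-- Reflecting (P, Q) in the nearest lower α₁-line lowers 2P + Q by 3(P % 3) and fixes P + 2Q; an
α₂-line does the reverse. The nearest lower ρ-line lowers both by 3((P + Q) % 3). If neither simple
step is available, this last one is. -/
theorem le_sub_of_no_simple_step {A B P Q : ℤ} (hA : 0 < A) (hB : 0 < B)
    (h : A % 3 = B % 3 ∧ A % 3 ≠ 0) (h' : P % 3 = Q % 3 ∧ P % 3 ≠ 0) (hne : ¬(P = A ∧ Q = B))
    (h₀ : -3 ≤ P + Q) (h₁ : -3 ≤ P) (h₂ : -3 ≤ Q)
    (d₁ : 2 * A + B ≤ 2 * P + Q) (d₂ : A + 2 * B ≤ P + 2 * Q)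
    (e₁ : ¬(0 < P ∧ 2 * A + B ≤ 2 * P + Q - 3 * (P % 3)))
    (e₂ : ¬(0 < Q ∧ A + 2 * B ≤ P + 2 * Q - 3 * (Q % 3))) :
    2 * A + B ≤ 2 * P + Q - 3 * ((P + Q) % 3) ∧
      A + 2 * B ≤ P + 2 * Q - 3 * ((P + Q) % 3) ∧ 0 < P + Q := by
  -- Both functionals take multiples of 3 here. After division by 3 their two excesses sum to 2(ε -
  -- δ) modulo 3. For P, Q > 0 and ε = 1, blocked simple steps force both excesses to vanish; for ε
  -- = 2 each is 0 or 1, the sum cannot be 1, and only (1, 1) remains.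
  obtain ⟨a, b, δ, rfl, rfl, hδ⟩ : ∃ a b δ, A = 3 * a + δ ∧ B = 3 * b + δ ∧ (δ = 1 ∨ δ = 2) :=
    ⟨A / 3, B / 3, A % 3, by omega, by omega, by omega⟩
  obtain ⟨u, v, ε, rfl, rfl, hε⟩ : ∃ u v ε, P = 3 * u + ε ∧ Q = 3 * v + ε ∧ (ε = 1 ∨ ε = 2) :=
    ⟨P / 3, Q / 3, P % 3, by omega, by omega, by omega⟩
  clear h h'
  rcases hε with rfl | rfl
  · have r₁ : (3 * u + 1) % 3 = 1 := by omega
    have r₂ : (3 * v + 1) % 3 = 1 := by omega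
    rw [r₁] at e₁
    rw [r₂] at e₂
    exfalso
    rcases hδ with rfl | rfl <;> omega
  · have r₁ : (3 * u + 2) % 3 = 2 := by omega
    have r₂ : (3 * v + 2) % 3 = 2 := by omega
    have r₃ : (3 * u + 2 + (3 * v + 2)) % 3 = 1 := by omega
    rw [r₁] at e₁
    rw [r₂] at e₂
    rw [r₃]
    rcases hδ with rfl | rfl <;> omega

/-- The descent step. Far from the dominant zone, a line through `-ϖ₁` or `-ϖ₂` serves. Otherwise
both maxima are attained at the dominant functionals, and the nearest line below the alcove in one
of the three root directions serves. -/
theorem exists_root_reflect_height_le {a p : ℤ × ℤ} (ha₁ : 0 < a.1) (ha₂ : 0 < a.2)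
    (ha : a.1 % 3 = a.2 % 3 ∧ a.1 % 3 ≠ 0) (hp : p.1 % 3 = p.2 % 3 ∧ p.1 % 3 ≠ 0)
    (h₁ : height₁ a ≤ height₁ p) (h₂ : height₂ a ≤ height₂ p) (hne : p ≠ a) :
    ∃ r : AffineRoot, r.val (-1, -1) * r.val p < 0 ∧
      height₁ a ≤ height₁ (r.reflect p) ∧ height₂ a ≤ height₂ (r.reflect p) := by
  obtain ⟨A, B⟩ := a
  obtain ⟨P, Q⟩ := p
  simp only [ne_eq, Prod.mk.injEq] at hne
  simp only [height₁, height₂, reflect_apply, val] at *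
  -- The line (ρ, v) = -1 contains both base vertices, so this reflection fixes both heights.
  by_cases c₁ : P + Q < -3
  · exact ⟨⟨1, 1, 1, by decide⟩, by dsimp only; omega, by dsimp only; omega, by dsimp only; omega⟩
  -- The line (α₁, v) = -1 contains `-ϖ₁`, so `height₁` is fixed. Given `c₁`, `height₂` is attained
  -- at ϖ₂, which is orthogonal to α₁. The case `c₃` is symmetric.
  by_cases c₂ : P < -3
  · exact ⟨⟨1, 0, 1, by decide⟩, by dsimp only; omega, by dsimp only; omega, by dsimp only; omega⟩
  by_cases c₃ : Q < -3
  · exact ⟨⟨0, 1, 1, by decide⟩, by dsimp only; omega, by dsimp only; omega, by dsimp only; omega⟩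
  have d₁ : 2 * A + B ≤ 2 * P + Q := by omega
  have d₂ : A + 2 * B ≤ P + 2 * Q := by omega
  have neg_of : ∀ k c : ℤ, 0 ≤ k → 0 < c → (-1 + 3 * -k) * c < 0 :=
    fun k c hk hc => mul_neg_of_neg_of_pos (by omega) hc
  by_cases e₁ : 0 < P ∧ 2 * A + B ≤ 2 * P + Q - 3 * (P % 3)
  · refine ⟨⟨1, 0, -(P / 3), by decide⟩, ?_, ?_, ?_⟩
    · have := neg_of (P / 3) (P + 3 * -(P / 3)) (by omega) (by omega)
      simpa using this
    · dsimp only; omega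
    · dsimp only; omega
  by_cases e₂ : 0 < Q ∧ A + 2 * B ≤ P + 2 * Q - 3 * (Q % 3)
  · refine ⟨⟨0, 1, -(Q / 3), by decide⟩, ?_, ?_, ?_⟩
    · have := neg_of (Q / 3) (Q + 3 * -(Q / 3)) (by omega) (by omega)
      simpa using this
    · dsimp only; omega
    · dsimp only; omega
  have d₃ : 2 * A + B ≤ 2 * P + Q - 3 * ((P + Q) % 3) ∧
      A + 2 * B ≤ P + 2 * Q - 3 * ((P + Q) % 3) ∧ 0 < P + Q :=
    le_sub_of_no_simple_step ha₁ ha₂ ha hp hne (by omega) (by omega) (by omega) d₁ d₂ e₁ e₂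
  refine ⟨⟨1, 1, -((P + Q) / 3), by decide⟩, ?_, ?_, ?_⟩
  · have := mul_neg_of_neg_of_pos (a := -2 + 3 * -((P + Q) / 3))
      (b := P + Q + 3 * -((P + Q) / 3)) (by omega) (by omega)
    simpa using this
  · dsimp only; omega
  · dsimp only; omega

theorem bruhatLE_of_height_le {x : W} (h₁ : 0 < (center x).1) (h₂ : 0 < (center x).2) (z : W)
    (hz₁ : height₁ (center x) ≤ height₁ (center z))
    (hz₂ : height₂ (center x) ≤ height₂ (center z)) : BruhatLE x z := by
  induction hn : cs.length z using Nat.strong_induction_on generalizing z with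
  | _ n ih =>
  subst hn
  by_cases hne : center z = center x
  · rw [center_injective hne]
    exact Relation.ReflTransGen.refl
  obtain ⟨r, hr, hr₁, hr₂⟩ := exists_root_reflect_height_le h₁ h₂ (center_mod_three x)
    (center_mod_three z) hz₁ hz₂ hne
  obtain ⟨t, ht, htr⟩ := exists_isReflection_of_root r
  have hlt : cs.length (t * z) < cs.length z := by
    rcases mul_neg_iff.mp hr with ⟨h, h'⟩ | ⟨h, h'⟩
    · exact length_reflection_mul_lt t r htr h z h'
    · exact length_reflection_mul_lt t r.neg (fun p => by rw [htr, reflect_neg])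
        (by rw [val_neg]; omega) z (by rw [val_neg]; omega)
  rw [← htr, ← center_mul] at hr₁ hr₂
  refine Relation.ReflTransGen.tail (ih _ hlt (t * z) hr₁ hr₂ rfl) ⟨z⁻¹ * t * z, ?_, ?_, hlt⟩
  · simpa using ht.conj z⁻¹
  · calc z = t * t * z := by rw [ht.mul_self, one_mul]
      _ = _ := by group

/-- The Bruhat order above a dominant element, in terms of the positions of the alcoves. -/
theorem bruhatLE_iff {x : W} (h₁ : 0 < (center x).1) (h₂ : 0 < (center x).2) (z : W) :
    BruhatLE x z ↔ height₁ (center x) ≤ height₁ (center z) ∧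
      height₂ (center x) ≤ height₂ (center z) :=
  ⟨height_le_of_bruhatLE, fun h => bruhatLE_of_height_le h₁ h₂ z h.1 h.2⟩

/-! ### Coordinates on the plane -/

/-- The point `a α₁ + b α₂` of the plane. -/
noncomputable def pt (a b : ℝ) : E := a • α₁ + b • α₂

theorem inner_α₁_pt (a b : ℝ) : inner ℝ α₁ (pt a b) = 2 * a - b := by
  simp only [pt, inner_add_right, inner_smul_right, inner_α₁_α₁, inner_α₁_α₂]; ring

theorem inner_α₂_pt (a b : ℝ) : inner ℝ α₂ (pt a b) = 2 * b - a := by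
  simp only [pt, inner_add_right, inner_smul_right, inner_α₂_α₁, inner_α₂_α₂]; ring

theorem inner_ρ_pt (a b : ℝ) : inner ℝ ρ (pt a b) = a + b := by
  simp only [ρ, inner_add_left, inner_α₁_pt, inner_α₂_pt]; ring

theorem inner_ρ_ρ : inner ℝ ρ ρ = 2 := by
  simp only [ρ, inner_add_left, inner_add_right, inner_α₁_α₁, inner_α₂_α₂, inner_α₁_α₂,
    inner_α₂_α₁]
  norm_num

theorem eq_zero_of_inner_eq_zero {v : E} (h₁ : inner ℝ α₁ v = 0) (h₂ : inner ℝ α₂ v = 0) :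
    v = 0 := by
  simp only [α₁, α₂, PiLp.inner_apply, Fin.sum_univ_two] at h₁ h₂
  simp at h₁ h₂
  have h6 : (0 : ℝ) < √6 := by positivity
  have h2 : (0 : ℝ) < √2 := by positivity
  have e₁ : √2 * v 1 = 0 := by linarith
  have e₀ : √6 * v 0 = 0 := by linarith
  ext i
  fin_cases i
  · simpa [h6.ne'] using e₀
  · simpa [h2.ne'] using e₁

/-- The coordinate `(ϖ₁, v)`. -/
noncomputable def coord₁ (v : E) : ℝ := (2 * inner ℝ α₁ v + inner ℝ α₂ v) / 3

/-- The coordinate `(ϖ₂, v)`. -/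
noncomputable def coord₂ (v : E) : ℝ := (inner ℝ α₁ v + 2 * inner ℝ α₂ v) / 3

@[simp] theorem coord₁_pt (a b : ℝ) : coord₁ (pt a b) = a := by
  rw [coord₁, inner_α₁_pt, inner_α₂_pt]; ring

@[simp] theorem coord₂_pt (a b : ℝ) : coord₂ (pt a b) = b := by
  rw [coord₂, inner_α₁_pt, inner_α₂_pt]; ring

theorem pt_coord (v : E) : pt (coord₁ v) (coord₂ v) = v := by
  rw [← sub_eq_zero]
  apply eq_zero_of_inner_eq_zero
  · rw [inner_sub_right, inner_α₁_pt, coord₁, coord₂]; ring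
  · rw [inner_sub_right, inner_α₂_pt, coord₁, coord₂]; ring

theorem exists_eq_pt (v : E) : ∃ a b, v = pt a b := ⟨_, _, (pt_coord v).symm⟩

theorem continuous_coord₁ : Continuous coord₁ := by unfold coord₁; fun_prop

theorem continuous_coord₂ : Continuous coord₂ := by unfold coord₂; fun_prop

theorem smul_pt (c a b : ℝ) : c • pt a b = pt (c * a) (c * b) := by
  simp only [pt]; module

theorem pt_add_pt (a b a' b' : ℝ) : pt a b + pt a' b' = pt (a + a') (b + b') := by
  simp only [pt]; module

theorem pt_sub_pt (a b a' b' : ℝ) : pt a b - pt a' b' = pt (a - a') (b - b') := by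
  simp only [pt]; module

theorem neg_pt (a b : ℝ) : -pt a b = pt (-a) (-b) := by
  simp only [pt]; module

theorem zero_eq_pt : (0 : E) = pt 0 0 := by simp [pt]

theorem ϖ₁_eq_pt : ϖ₁ = pt (2 / 3) (1 / 3) := by
  simp only [ϖ₁, pt]; module

theorem ϖ₂_eq_pt : ϖ₂ = pt (1 / 3) (2 / 3) := by
  simp only [ϖ₂, pt]; module

theorem affineReflection_α₁_pt (k a b : ℝ) :
    affineReflection α₁ k (pt a b) = pt (b - a + k) b := by
  rw [affineReflection_apply, inner_α₁_pt, inner_α₁_α₁]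
  simp only [pt]; module

theorem affineReflection_α₂_pt (k a b : ℝ) :
    affineReflection α₂ k (pt a b) = pt a (a - b + k) := by
  rw [affineReflection_apply, inner_α₂_pt, inner_α₂_α₂]
  simp only [pt]; module

theorem affineReflection_ρ_pt (k a b : ℝ) :
    affineReflection ρ k (pt a b) = pt (k - b) (k - a) := by
  rw [affineReflection_apply, inner_ρ_pt, inner_ρ_ρ]
  simp only [ρ, pt]; module

/-! ### Comparison of the actions on the plane and on the lattice -/

theorem act_simple (i : Fin 3) : act (cs.simple i) = simpleReflection i :=
  cs.lift_apply_simple simpleReflection_isLiftable i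

theorem act_mul (u v : W) (p : E) : act (u * v) p = act u (act v p) := by
  rw [map_mul, Equiv.Perm.mul_apply]

/-- The point `v` with `3 (α₁, v) = p.1` and `3 (α₂, v) = p.2`. -/
noncomputable def ofLattice (p : ℤ × ℤ) : E := pt ((2 * p.1 + p.2) / 9) ((p.1 + 2 * p.2) / 9)

theorem act_ofLattice (w : W) (p : ℤ × ℤ) : act w (ofLattice p) = ofLattice (latticeAct w p) := by
  refine cs.simple_induction_left
    (p := fun w => act w (ofLattice p) = ofLattice (latticeAct w p)) w (by simp) ?_
  intro w i ih
  rw [act_mul, ih, latticeAct_mul, act_simple, latticeAct_simple]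
  generalize latticeAct w p = q
  fin_cases i <;>
    simp [simpleReflection, ofLattice, affineReflection_ρ_pt, affineReflection_α₁_pt,
      affineReflection_α₂_pt, reflect_apply, simple, val] <;> congr 1 <;> ring

theorem sum_vertices (w : W) :
    (latticeAct w (0, 0)).1 + (latticeAct w (-3, 0)).1 + (latticeAct w (0, -3)).1 =
      3 * (center w).1 ∧
    (latticeAct w (0, 0)).2 + (latticeAct w (-3, 0)).2 + (latticeAct w (0, -3)).2 =
      3 * (center w).2 := by
  refine cs.simple_induction_left (p := fun w =>
    (latticeAct w (0, 0)).1 + (latticeAct w (-3, 0)).1 + (latticeAct w (0, -3)).1 =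
      3 * (center w).1 ∧
    (latticeAct w (0, 0)).2 + (latticeAct w (-3, 0)).2 + (latticeAct w (0, -3)).2 =
      3 * (center w).2) w (by rw [center_one]; simp) ?_
  intro w i ih
  simp only [center_mul, latticeAct_mul, latticeAct_simple]
  fin_cases i <;> simp [reflect_apply, simple, val] <;> omega

theorem cen_eq_ofLattice (z : W) : cen z = ofLattice (center z) := by
  have e₀ : (0 : E) = ofLattice (0, 0) := by simp [ofLattice, ← zero_eq_pt]
  have e₁ : -ϖ₁ = ofLattice (-3, 0) := by
    rw [ϖ₁_eq_pt, neg_pt, ofLattice]; congr 1 <;> norm_num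
  have e₂ : -ϖ₂ = ofLattice (0, -3) := by
    rw [ϖ₂_eq_pt, neg_pt, ofLattice]; congr 1 <;> norm_num
  rw [cen, e₁, e₂, e₀, act_ofLattice, act_ofLattice, act_ofLattice]
  obtain ⟨h₁, h₂⟩ := sum_vertices z
  have h₁' := congrArg (Int.cast : ℤ → ℝ) h₁
  have h₂' := congrArg (Int.cast : ℤ → ℝ) h₂
  push_cast at h₁' h₂'
  simp only [ofLattice, pt_add_pt, smul_pt]
  congr 1 <;> linarith

/-- The value of an affine root at a point of the plane. -/
noncomputable def AffineRoot.eval (r : AffineRoot) (v : E) : ℝ :=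
  r.m * inner ℝ α₁ v + r.n * inner ℝ α₂ v + r.k

theorem exists_root_comp_act (w : W) :
    ∀ r : AffineRoot, ∃ r' : AffineRoot, ∀ v, r'.eval v = r.eval (act w v) := by
  refine cs.simple_induction_right (p := fun w =>
    ∀ r : AffineRoot, ∃ r' : AffineRoot, ∀ v, r'.eval v = r.eval (act w v)) w
    (fun r => ⟨r, by simp⟩) ?_
  intro w i ih r
  obtain ⟨r₁, h₁⟩ := ih r
  refine ⟨r₁.compSimple i, fun v => ?_⟩
  rw [act_mul, ← h₁, act_simple]
  obtain ⟨a, b, rfl⟩ := exists_eq_pt v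
  fin_cases i <;>
    simp [simpleReflection, affineReflection_ρ_pt, affineReflection_α₁_pt,
      affineReflection_α₂_pt, eval, inner_α₁_pt, inner_α₂_pt, compSimple, simple] <;> ring

/-- Affine roots do not change sign on an alcove: after pullback to `A₊`, where positive roots take
values in (-1, 0), the sign is decided by the integer constant term. -/
theorem eval_cen_pos (r : AffineRoot) {x : W} {v : E} (hv : v ∈ alcove x) (h : 0 < r.eval v) :
    0 < r.eval (cen x) := by
  obtain ⟨u, hu, rfl⟩ := hv
  obtain ⟨r', h'⟩ := exists_root_comp_act x r
  have e : cen x = act x (ofLattice (-1, -1)) := by rw [cen_eq_ofLattice, center, act_ofLattice]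
  rw [e, ← h']
  rw [← h'] at h
  obtain ⟨u₁, u₁'⟩ := hu α₁ (by simp)
  obtain ⟨u₂, u₂'⟩ := hu α₂ (by simp)
  obtain ⟨u₃, u₃'⟩ := hu ρ (by simp)
  rw [ρ, inner_add_left] at u₃ u₃'
  obtain ⟨m, n, k, hr⟩ := r'
  rcases hr with hr | hr | hr | hr | hr | hr <;> obtain ⟨rfl, rfl⟩ := hr <;>
    simp [eval, ofLattice, inner_α₁_pt, inner_α₂_pt] at h ⊢
  · have : (1 : ℝ) ≤ k := by
      have : (0 : ℝ) < k := by linarith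
      exact_mod_cast this
    linarith
  · have : (1 : ℝ) ≤ k := by
      have : (0 : ℝ) < k := by linarith
      exact_mod_cast this
    linarith
  · have : (1 : ℝ) ≤ k := by
      have : (0 : ℝ) < k := by linarith
      exact_mod_cast this
    linarith
  all_goals
    have : (0 : ℝ) < k + 1 := by linarith
    have : (0 : ℝ) ≤ k := by
      have h0 : 0 < k + 1 := by exact_mod_cast this
      exact_mod_cast Int.lt_add_one_iff.mp h0
    linarith

theorem center_pos_of_isDominant {x : W} (hx : IsDominant x) :
    0 < (center x).1 ∧ 0 < (center x).2 := by
  obtain ⟨v, hv, h₁, h₂⟩ := hx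
  have e₁ := eval_cen_pos ⟨1, 0, 0, by decide⟩ hv (by simpa [eval] using h₁)
  have e₂ := eval_cen_pos ⟨0, 1, 0, by decide⟩ hv (by simpa [eval] using h₂)
  simp only [eval, cen_eq_ofLattice, ofLattice, inner_α₁_pt, inner_α₂_pt] at e₁ e₂
  push_cast at e₁ e₂
  constructor
  · have : (0 : ℝ) < (center x).1 := by linarith
    exact_mod_cast this
  · have : (0 : ℝ) < (center x).2 := by linarith
    exact_mod_cast this

open Set

/-! ### Filling a closed curve -/

/-- `K` need only lie in `S` and contain `S \ O`. Points outside `S` escape to infinity along rays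
from `c`, hence lie in unbounded components; a component that meets `O` cannot leave it without
crossing `K`. -/
theorem union_bounded_components_eq {K S O : Set E} {c : E} (hK : K ⊆ S) (hO : IsOpen O)
    (hS : IsClosed S) (hOS : O ⊆ S) (hSO : S \ O ⊆ K) (hb : Bornology.IsBounded S) (hc : c ∈ S)
    (hray : ∀ v ∉ S, ∀ s : ℝ, 1 ≤ s → c + s • (v - c) ∉ S) :
    K ∪ {v | v ∈ Kᶜ ∧ Bornology.IsBounded (connectedComponentIn Kᶜ v)} = S := by
  ext v
  constructor
  · rintro (hv | ⟨hv, hbv⟩)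
    · exact hK hv
    by_contra hvS
    have hne : v - c ≠ 0 := by
      rw [sub_ne_zero]; rintro rfl; exact hvS hc
    have hsub : (fun s : ℝ => c + s • (v - c)) '' Ici 1 ⊆ connectedComponentIn Kᶜ v := by
      refine IsPreconnected.subset_connectedComponentIn ?_ ⟨1, by simp, by simp⟩ ?_
      · exact isPreconnected_Ici.image _ (by fun_prop)
      · rintro _ ⟨s, hs, rfl⟩ h
        exact hray v hvS s hs (hK h)
    obtain ⟨R, hR⟩ := (hbv.subset hsub).exists_norm_le
    have hpos : 0 < ‖v - c‖ := norm_pos_iff.mpr hne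
    -- The parameter places the point at distance more than |R| + ‖c‖ from `c`, hence outside the
    -- ball of radius R.
    have h₁ := hR _ ⟨1 + (|R| + ‖c‖ + 1) / ‖v - c‖, by
      simp only [mem_Ici, le_add_iff_nonneg_right]; positivity, rfl⟩
    have h₂ := norm_sub_le (c + (1 + (|R| + ‖c‖ + 1) / ‖v - c‖) • (v - c)) c
    rw [add_sub_cancel_left, norm_smul, Real.norm_of_nonneg (by positivity), add_mul,
      div_mul_cancel₀ _ hpos.ne'] at h₂
    have h₃ := le_abs_self R
    linarith
  · intro hv
    by_cases hvK : v ∈ K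
    · exact Or.inl hvK
    refine Or.inr ⟨hvK, hb.subset (Subset.trans ?_ hOS)⟩
    have hvO : v ∈ O := by_contra fun h => hvK (hSO ⟨hv, h⟩)
    refine isPreconnected_connectedComponentIn.subset_left_of_subset_union hO hS.isOpen_compl
      ?_ ?_ ⟨v, mem_connectedComponentIn hvK, hvO⟩
    · exact disjoint_left.mpr fun w hw hw' => hw' (hOS hw)
    · intro w hw
      by_contra h
      simp only [mem_union, mem_compl_iff, not_or, not_not] at h
      exact connectedComponentIn_subset _ _ hw (hSO ⟨h.2, h.1⟩)

/-- A point outside `O` is a limit of points further out on its ray, and these are not in `S`. -/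
theorem interior_eq_of_ray {S O : Set E} {c : E} (hO : IsOpen O) (hOS : O ⊆ S)
    (hray : ∀ v ∉ O, ∀ s : ℝ, 1 < s → c + s • (v - c) ∉ S) : interior S = O := by
  refine Subset.antisymm (fun v hv => ?_) (interior_maximal hOS hO)
  by_contra h
  have hcont : Continuous fun s : ℝ => c + s • (v - c) := by fun_prop
  have hmem : (fun s : ℝ => c + s • (v - c)) ⁻¹' interior S ∈ nhds (1 : ℝ) :=
    (isOpen_interior.preimage hcont).mem_nhds (by simpa using hv)
  have hmem' := mem_nhdsWithin_of_mem_nhds (t := Ioi 1) hmem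
  obtain ⟨s, hs, hs'⟩ := Filter.nonempty_of_mem (Filter.inter_mem hmem' self_mem_nhdsWithin)
  exact hray v h s hs' (interior_subset hs)

/-! ### The star as a union of two triangles -/

/-- The maximum of the functionals in the orbit of `ϖ₁`, based at `-ϖ₁`. -/
noncomputable def gauge₁ (v : E) : ℝ :=
  max (coord₁ v) (max (coord₂ v - coord₁ v - 1) (-coord₂ v - 1))

/-- The maximum of the functionals in the orbit of `ϖ₂`, based at `-ϖ₂`. -/
noncomputable def gauge₂ (v : E) : ℝ :=
  max (coord₂ v) (max (coord₁ v - coord₂ v - 1) (-coord₁ v - 1))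

theorem continuous_gauge₁ : Continuous gauge₁ := by
  have := continuous_coord₁
  have := continuous_coord₂
  unfold gauge₁; fun_prop

theorem continuous_gauge₂ : Continuous gauge₂ := by
  have := continuous_coord₁
  have := continuous_coord₂
  unfold gauge₂; fun_prop

theorem gauge₁_pt_le_iff {a b c : ℝ} :
    gauge₁ (pt a b) ≤ c ↔ a ≤ c ∧ b - a - 1 ≤ c ∧ -b - 1 ≤ c := by simp [gauge₁]

theorem gauge₂_pt_le_iff {a b c : ℝ} :
    gauge₂ (pt a b) ≤ c ↔ b ≤ c ∧ a - b - 1 ≤ c ∧ -a - 1 ≤ c := by simp [gauge₂]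

theorem le_gauge₁_pt_iff {a b c : ℝ} :
    c ≤ gauge₁ (pt a b) ↔ c ≤ a ∨ c ≤ b - a - 1 ∨ c ≤ -b - 1 := by simp [gauge₁]

theorem le_gauge₂_pt_iff {a b c : ℝ} :
    c ≤ gauge₂ (pt a b) ↔ c ≤ b ∨ c ≤ a - b - 1 ∨ c ≤ -a - 1 := by simp [gauge₂]

theorem convex_gauge₁_le (c : ℝ) : Convex ℝ {v | gauge₁ v ≤ c} := by
  intro u hu v hv s t hs ht hst
  obtain ⟨a, b, rfl⟩ := exists_eq_pt u
  obtain ⟨a', b', rfl⟩ := exists_eq_pt v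
  simp only [mem_ofPred_eq, smul_pt, pt_add_pt, gauge₁_pt_le_iff] at *
  obtain rfl : t = 1 - s := by linarith
  refine ⟨?_, ?_, ?_⟩ <;> nlinarith

theorem convex_gauge₂_le (c : ℝ) : Convex ℝ {v | gauge₂ v ≤ c} := by
  intro u hu v hv s t hs ht hst
  obtain ⟨a, b, rfl⟩ := exists_eq_pt u
  obtain ⟨a', b', rfl⟩ := exists_eq_pt v
  simp only [mem_ofPred_eq, smul_pt, pt_add_pt, gauge₂_pt_le_iff] at *
  obtain rfl : t = 1 - s := by linarith
  refine ⟨?_, ?_, ?_⟩ <;> nlinarith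

/-- The center of `A₊`. -/
noncomputable def origin : E := pt (-(1 / 3)) (-(1 / 3))

/-- Convexity along the ray from `origin`, where both gauges equal -1/3. Hence a gauge above -1/3
grows strictly outwards. -/
theorem gauge_ray (v : E) {s : ℝ} (hs : 1 ≤ s) :
    gauge₁ v + (s - 1) * (gauge₁ v + 1 / 3) ≤ gauge₁ (origin + s • (v - origin)) ∧
      gauge₂ v + (s - 1) * (gauge₂ v + 1 / 3) ≤ gauge₂ (origin + s • (v - origin)) := by
  obtain ⟨a, b, rfl⟩ := exists_eq_pt v
  rw [origin, pt_sub_pt, smul_pt, pt_add_pt]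
  constructor
  · rw [le_gauge₁_pt_iff]
    rcases le_gauge₁_pt_iff.mp (le_refl (gauge₁ (pt a b))) with h | h | h
    · exact Or.inl (by nlinarith)
    · exact Or.inr (Or.inl (by nlinarith))
    · exact Or.inr (Or.inr (by nlinarith))
  · rw [le_gauge₂_pt_iff]
    rcases le_gauge₂_pt_iff.mp (le_refl (gauge₂ (pt a b))) with h | h | h
    · exact Or.inl (by nlinarith)
    · exact Or.inr (Or.inl (by nlinarith))
    · exact Or.inr (Or.inr (by nlinarith))

/-! ### The vertices of the star -/

theorem innerVertex_eq {x : W} {A B : ℝ} (h : cen x = pt A B) :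
    innerVertex x 0 = pt A B ∧ innerVertex x 1 = pt (B - A - 1) B ∧
    innerVertex x 2 = pt (-B - 1) (A - B) ∧ innerVertex x 3 = pt (-B - 1) (-A - 1) ∧
    innerVertex x 4 = pt (B - A) (-A - 1) ∧ innerVertex x 5 = pt A (A - B - 1) ∧
    innerVertex x 6 = pt A B := by
  have h₀ : innerVertex x 0 = pt A B := h
  have h₁ : innerVertex x 1 = pt (B - A - 1) B := by
    change affineReflection α₁ (-1) (innerVertex x 0) = _
    rw [h₀, affineReflection_α₁_pt]; congr 1
  have h₂ : innerVertex x 2 = pt (-B - 1) (A - B) := by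
    change affineReflection ρ (-1) (innerVertex x 1) = _
    rw [h₁, affineReflection_ρ_pt]; congr 1 <;> ring
  have h₃ : innerVertex x 3 = pt (-B - 1) (-A - 1) := by
    change affineReflection α₂ 0 (innerVertex x 2) = _
    rw [h₂, affineReflection_α₂_pt]; congr 1; ring
  have h₄ : innerVertex x 4 = pt (B - A) (-A - 1) := by
    change affineReflection α₁ 0 (innerVertex x 3) = _
    rw [h₃, affineReflection_α₁_pt]; congr 1; ring
  have h₅ : innerVertex x 5 = pt A (A - B - 1) := by
    change affineReflection ρ (-1) (innerVertex x 4) = _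
    rw [h₄, affineReflection_ρ_pt]; congr 1 <;> ring
  refine ⟨h₀, h₁, h₂, h₃, h₄, h₅, ?_⟩
  change affineReflection α₂ (-1) (innerVertex x 5) = _
  rw [h₅, affineReflection_α₂_pt]; congr 1; ring

theorem norm_sq_pt (a b : ℝ) : ‖pt a b‖ ^ 2 = 2 * (a ^ 2 - a * b + b ^ 2) := by
  rw [← real_inner_self_eq_norm_sq]
  conv_lhs => enter [2]; rw [pt]
  rw [inner_add_left, inner_smul_left, inner_smul_left, inner_α₁_pt, inner_α₂_pt]
  simp only [conj_trivial]
  ring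

/-- By `h₁` the base has length √2·m, and by `h₂` the direction has length √(2/3), as do all six ray
directions. The factor is therefore (√3/2)·√2·m/√(2/3) = 3m/2. -/
theorem apex_eq {a b a' b' c d m : ℝ} (hm : 0 ≤ m)
    (h₁ : (a - a') ^ 2 - (a - a') * (b - b') + (b - b') ^ 2 = m ^ 2)
    (h₂ : c ^ 2 - c * d + d ^ 2 = 1 / 3) :
    midpoint ℝ (pt a b) (pt a' b') + (√3 / 2 * dist (pt a b) (pt a' b') / ‖pt c d‖) • pt c d =
      pt ((a + a') / 2 + 3 / 2 * m * c) ((b + b') / 2 + 3 / 2 * m * d) := by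
  have hpos : 0 < ‖pt c d‖ := by
    have := norm_sq_pt c d
    rw [h₂] at this
    by_contra h
    have h0 : ‖pt c d‖ = 0 := le_antisymm (not_lt.mp h) (norm_nonneg _)
    rw [h0] at this
    norm_num at this
  have h : √3 / 2 * dist (pt a b) (pt a' b') / ‖pt c d‖ = 3 / 2 * m := by
    rw [div_eq_iff hpos.ne', dist_eq_norm, pt_sub_pt]
    apply (sq_eq_sq₀ (by positivity) (by positivity)).mp
    rw [mul_pow, mul_pow, div_pow, norm_sq_pt, norm_sq_pt, h₁, h₂, Real.sq_sqrt (by norm_num)]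
    ring
  rw [h, midpoint_eq_smul_add, pt_add_pt, smul_pt, smul_pt, pt_add_pt]
  congr 1
  · rw [invOf_eq_inv]; ring
  · rw [invOf_eq_inv]; ring

theorem outerVertex_eq {x : W} {A B : ℝ} (h : cen x = pt A B) (h₁ : 0 < 2 * A - B)
    (h₂ : 0 < 2 * B - A) :
    outerVertex x 0 = pt A (2 * A + 1) ∧ outerVertex x 1 = pt (-B - 1) B ∧
    outerVertex x 2 = pt (-2 * A - 2) (-A - 1) ∧ outerVertex x 3 = pt (-B - 1) (-2 * B - 2) ∧
    outerVertex x 4 = pt A (-A - 1) ∧ outerVertex x 5 = pt (2 * B + 1) B := by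
  obtain ⟨i₀, i₁, i₂, i₃, i₄, i₅, i₆⟩ := innerVertex_eq h
  refine ⟨?_, ?_, ?_, ?_, ?_, ?_⟩
  · change midpoint ℝ (innerVertex x 0) (innerVertex x 1) +
      (√3 / 2 * dist (innerVertex x 0) (innerVertex x 1) / ‖ϖ₂‖) • ϖ₂ = _
    rw [i₀, i₁, ϖ₂_eq_pt, apex_eq (m := 2 * A - B + 1) (by linarith) (by ring) (by norm_num)]
    congr 1 <;> ring
  · change midpoint ℝ (innerVertex x 1) (innerVertex x 2) +
      (√3 / 2 * dist (innerVertex x 1) (innerVertex x 2) / ‖ϖ₂ - ϖ₁‖) • (ϖ₂ - ϖ₁) = _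
    rw [i₁, i₂, ϖ₁_eq_pt, ϖ₂_eq_pt, pt_sub_pt,
      apex_eq (m := 2 * B - A) (by linarith) (by ring) (by norm_num)]
    congr 1 <;> ring
  · change midpoint ℝ (innerVertex x 2) (innerVertex x 3) +
      (√3 / 2 * dist (innerVertex x 2) (innerVertex x 3) / ‖-ϖ₁‖) • (-ϖ₁) = _
    rw [i₂, i₃, ϖ₁_eq_pt, neg_pt,
      apex_eq (m := 2 * A - B + 1) (by linarith) (by ring) (by norm_num)]
    congr 1 <;> ring
  · change midpoint ℝ (innerVertex x 3) (innerVertex x 4) +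
      (√3 / 2 * dist (innerVertex x 3) (innerVertex x 4) / ‖-ϖ₂‖) • (-ϖ₂) = _
    rw [i₃, i₄, ϖ₂_eq_pt, neg_pt,
      apex_eq (m := 2 * B - A + 1) (by linarith) (by ring) (by norm_num)]
    congr 1 <;> ring
  · change midpoint ℝ (innerVertex x 4) (innerVertex x 5) +
      (√3 / 2 * dist (innerVertex x 4) (innerVertex x 5) / ‖ϖ₁ - ϖ₂‖) • (ϖ₁ - ϖ₂) = _
    rw [i₄, i₅, ϖ₁_eq_pt, ϖ₂_eq_pt, pt_sub_pt,
      apex_eq (m := 2 * A - B) (by linarith) (by ring) (by norm_num)]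
    congr 1 <;> ring
  · change midpoint ℝ (innerVertex x 5) (innerVertex x 6) +
      (√3 / 2 * dist (innerVertex x 5) (innerVertex x 6) / ‖ϖ₁‖) • ϖ₁ = _
    rw [i₅, i₆, ϖ₁_eq_pt,
      apex_eq (m := 2 * B - A + 1) (by linarith) (by ring) (by norm_num)]
    congr 1 <;> ring

theorem mem_segment_pt {a b a' b' p q : ℝ} (da db m s : ℝ) (hs : 0 ≤ s) (hm : s ≤ m)
    (ha : a' = a + m * da) (hb : b' = b + m * db) (hp : p = a + s * da) (hq : q = b + s * db) :
    pt p q ∈ segment ℝ (pt a b) (pt a' b') := by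
  subst ha hb hp hq
  rw [segment_eq_image']
  by_cases h : m = 0
  · obtain rfl : s = 0 := by linarith
    subst h
    exact ⟨0, by simp, by simp⟩
  · have hm' : 0 < m := lt_of_le_of_ne (hs.trans hm) (Ne.symm h)
    refine ⟨s / m, ⟨by positivity, (div_le_one hm').mpr hm⟩, ?_⟩
    simp only [pt_sub_pt, smul_pt, pt_add_pt]
    congr 1 <;> field_simp <;> ring

theorem mem_starBoundary_iff {x : W} {A B : ℝ} (h : cen x = pt A B) (h₁ : 0 < 2 * A - B)
    (h₂ : 0 < 2 * B - A) (v : E) : v ∈ starBoundary x ↔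
      (v ∈ segment ℝ (pt A B) (pt A (2 * A + 1)) ∨
        v ∈ segment ℝ (pt A (2 * A + 1)) (pt (B - A - 1) B)) ∨
      (v ∈ segment ℝ (pt (B - A - 1) B) (pt (-B - 1) B) ∨
        v ∈ segment ℝ (pt (-B - 1) B) (pt (-B - 1) (A - B))) ∨
      (v ∈ segment ℝ (pt (-B - 1) (A - B)) (pt (-2 * A - 2) (-A - 1)) ∨
        v ∈ segment ℝ (pt (-2 * A - 2) (-A - 1)) (pt (-B - 1) (-A - 1))) ∨
      (v ∈ segment ℝ (pt (-B - 1) (-A - 1)) (pt (-B - 1) (-2 * B - 2)) ∨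
        v ∈ segment ℝ (pt (-B - 1) (-2 * B - 2)) (pt (B - A) (-A - 1))) ∨
      (v ∈ segment ℝ (pt (B - A) (-A - 1)) (pt A (-A - 1)) ∨
        v ∈ segment ℝ (pt A (-A - 1)) (pt A (A - B - 1))) ∨
      (v ∈ segment ℝ (pt A (A - B - 1)) (pt (2 * B + 1) B) ∨
        v ∈ segment ℝ (pt (2 * B + 1) B) (pt A B)) := by
  obtain ⟨i₀, i₁, i₂, i₃, i₄, i₅, i₆⟩ := innerVertex_eq h
  obtain ⟨o₀, o₁, o₂, o₃, o₄, o₅⟩ := outerVertex_eq h h₁ h₂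
  rw [← i₀, ← i₁, ← i₂, ← i₃, ← i₄, ← i₅, ← o₀, ← o₁, ← o₂, ← o₃, ← o₄, ← o₅]
  have e : innerVertex x 0 = innerVertex x 6 := i₀.trans i₆.symm
  constructor
  · intro hv
    obtain ⟨i, hi⟩ := mem_iUnion.mp hv
    fin_cases i
    · exact Or.inl hi
    · exact Or.inr (Or.inl hi)
    · exact Or.inr (Or.inr (Or.inl hi))
    · exact Or.inr (Or.inr (Or.inr (Or.inl hi)))
    · exact Or.inr (Or.inr (Or.inr (Or.inr (Or.inl hi))))
    · refine Or.inr (Or.inr (Or.inr (Or.inr (Or.inr ?_))))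
      rw [e]
      exact hi
  · rintro (hv | hv | hv | hv | hv | hv)
    · exact mem_iUnion.mpr ⟨0, hv⟩
    · exact mem_iUnion.mpr ⟨1, hv⟩
    · exact mem_iUnion.mpr ⟨2, hv⟩
    · exact mem_iUnion.mpr ⟨3, hv⟩
    · exact mem_iUnion.mpr ⟨4, hv⟩
    · rw [e] at hv
      exact mem_iUnion.mpr ⟨5, hv⟩

/-- The two edges at each outer vertex lie in a single triangle, the triangles alternating with the
index; convexity reduces this to the endpoints. -/
theorem starBoundary_subset {x : W} {A B : ℝ} (h : cen x = pt A B) (h₁ : 0 < 2 * A - B)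
    (h₂ : 0 < 2 * B - A) : starBoundary x ⊆ {v | gauge₁ v ≤ A ∨ gauge₂ v ≤ B} := by
  have s₁ : ∀ {v : E} (a b a' b' : ℝ), gauge₁ (pt a b) ≤ A → gauge₁ (pt a' b') ≤ A →
      v ∈ segment ℝ (pt a b) (pt a' b') → gauge₁ v ≤ A ∨ gauge₂ v ≤ B :=
    fun _ _ _ _ hu hw hv => Or.inl ((convex_gauge₁_le A).segment_subset hu hw hv)
  have s₂ : ∀ {v : E} (a b a' b' : ℝ), gauge₂ (pt a b) ≤ B → gauge₂ (pt a' b') ≤ B →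
      v ∈ segment ℝ (pt a b) (pt a' b') → gauge₁ v ≤ A ∨ gauge₂ v ≤ B :=
    fun _ _ _ _ hu hw hv => Or.inr ((convex_gauge₂_le B).segment_subset hu hw hv)
  intro v hv
  rcases (mem_starBoundary_iff h h₁ h₂ v).mp hv with
    (hv | hv) | (hv | hv) | (hv | hv) | (hv | hv) | (hv | hv) | (hv | hv)
  · refine s₁ _ _ _ _ ?_ ?_ hv <;> rw [gauge₁_pt_le_iff] <;> refine ⟨?_, ?_, ?_⟩ <;> linarith
  · refine s₁ _ _ _ _ ?_ ?_ hv <;> rw [gauge₁_pt_le_iff] <;> refine ⟨?_, ?_, ?_⟩ <;> linarith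
  · refine s₂ _ _ _ _ ?_ ?_ hv <;> rw [gauge₂_pt_le_iff] <;> refine ⟨?_, ?_, ?_⟩ <;> linarith
  · refine s₂ _ _ _ _ ?_ ?_ hv <;> rw [gauge₂_pt_le_iff] <;> refine ⟨?_, ?_, ?_⟩ <;> linarith
  · refine s₁ _ _ _ _ ?_ ?_ hv <;> rw [gauge₁_pt_le_iff] <;> refine ⟨?_, ?_, ?_⟩ <;> linarith
  · refine s₁ _ _ _ _ ?_ ?_ hv <;> rw [gauge₁_pt_le_iff] <;> refine ⟨?_, ?_, ?_⟩ <;> linarith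
  · refine s₂ _ _ _ _ ?_ ?_ hv <;> rw [gauge₂_pt_le_iff] <;> refine ⟨?_, ?_, ?_⟩ <;> linarith
  · refine s₂ _ _ _ _ ?_ ?_ hv <;> rw [gauge₂_pt_le_iff] <;> refine ⟨?_, ?_, ?_⟩ <;> linarith
  · refine s₁ _ _ _ _ ?_ ?_ hv <;> rw [gauge₁_pt_le_iff] <;> refine ⟨?_, ?_, ?_⟩ <;> linarith
  · refine s₁ _ _ _ _ ?_ ?_ hv <;> rw [gauge₁_pt_le_iff] <;> refine ⟨?_, ?_, ?_⟩ <;> linarith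
  · refine s₂ _ _ _ _ ?_ ?_ hv <;> rw [gauge₂_pt_le_iff] <;> refine ⟨?_, ?_, ?_⟩ <;> linarith
  · refine s₂ _ _ _ _ ?_ ?_ hv <;> rw [gauge₂_pt_le_iff] <;> refine ⟨?_, ?_, ?_⟩ <;> linarith

/-- The open second triangle cuts a middle piece out of each side of the first. The two remaining
end pieces of each side are edges of the star. -/
theorem mem_starBoundary_of_gauge₁_eq {x : W} {A B : ℝ} (h : cen x = pt A B)
    (h₁ : 0 < 2 * A - B) (h₂ : 0 < 2 * B - A) {v : E} (hv₁ : gauge₁ v = A)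
    (hv₂ : B ≤ gauge₂ v) : v ∈ starBoundary x := by
  rw [mem_starBoundary_iff h h₁ h₂]
  obtain ⟨a, b, rfl⟩ := exists_eq_pt v
  obtain ⟨l₁, l₂, l₃⟩ := gauge₁_pt_le_iff.mp hv₁.le
  rw [le_gauge₂_pt_iff] at hv₂
  rcases le_gauge₁_pt_iff.mp hv₁.ge with e | e | e
  · obtain rfl : a = A := le_antisymm l₁ e
    by_cases hb : B ≤ b
    · refine Or.inl (Or.inl (mem_segment_pt 0 1 (2 * a - B + 1) (b - B) ?_ ?_ ?_ ?_ ?_ ?_)) <;>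
        linarith
    · have hb' : b ≤ a - B - 1 := by
        rcases hv₂ with hv₂ | hv₂ | hv₂ <;> linarith
      refine Or.inr (Or.inr (Or.inr (Or.inr (Or.inl (Or.inr ?_)))))
      rw [segment_symm]
      refine mem_segment_pt 0 (-1) (2 * a - B) (a - B - 1 - b) ?_ ?_ ?_ ?_ ?_ ?_ <;> linarith
  · obtain rfl : b = a + 1 + A := by linarith
    by_cases hb : B ≤ a + 1 + A
    · refine Or.inl (Or.inr ?_)
      rw [segment_symm]
      refine mem_segment_pt 1 1 (2 * A - B + 1) (a + 1 + A - B) ?_ ?_ ?_ ?_ ?_ ?_ <;> linarith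
    · have ha : a ≤ -B - 1 := by
        rcases hv₂ with hv₂ | hv₂ | hv₂ <;> linarith
      refine Or.inr (Or.inr (Or.inl (Or.inl ?_)))
      refine mem_segment_pt (-1) (-1) (2 * A - B + 1) (-B - 1 - a) ?_ ?_ ?_ ?_ ?_ ?_ <;> linarith
  · obtain rfl : b = -A - 1 := by linarith
    by_cases ha : a ≤ -B - 1
    · refine Or.inr (Or.inr (Or.inl (Or.inr ?_)))
      rw [segment_symm]
      refine mem_segment_pt (-1) 0 (2 * A - B + 1) (-B - 1 - a) ?_ ?_ ?_ ?_ ?_ ?_ <;> linarith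
    · have ha' : B - A ≤ a := by
        rcases hv₂ with hv₂ | hv₂ | hv₂ <;> linarith
      refine Or.inr (Or.inr (Or.inr (Or.inr (Or.inl (Or.inl ?_)))))
      refine mem_segment_pt 1 0 (2 * A - B) (a - (B - A)) ?_ ?_ ?_ ?_ ?_ ?_ <;> linarith

theorem mem_starBoundary_of_gauge₂_eq {x : W} {A B : ℝ} (h : cen x = pt A B)
    (h₁ : 0 < 2 * A - B) (h₂ : 0 < 2 * B - A) {v : E} (hv₁ : A ≤ gauge₁ v)
    (hv₂ : gauge₂ v = B) : v ∈ starBoundary x := by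
  rw [mem_starBoundary_iff h h₁ h₂]
  obtain ⟨a, b, rfl⟩ := exists_eq_pt v
  obtain ⟨l₁, l₂, l₃⟩ := gauge₂_pt_le_iff.mp hv₂.le
  rw [le_gauge₁_pt_iff] at hv₁
  rcases le_gauge₂_pt_iff.mp hv₂.ge with e | e | e
  · obtain rfl : b = B := le_antisymm l₁ e
    by_cases ha : A ≤ a
    · refine Or.inr (Or.inr (Or.inr (Or.inr (Or.inr (Or.inr ?_)))))
      rw [segment_symm]
      refine mem_segment_pt 1 0 (2 * b - A + 1) (a - A) ?_ ?_ ?_ ?_ ?_ ?_ <;> linarith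
    · have ha' : a ≤ b - A - 1 := by
        rcases hv₁ with hv₁ | hv₁ | hv₁ <;> linarith
      refine Or.inr (Or.inl (Or.inl ?_))
      refine mem_segment_pt (-1) 0 (2 * b - A) (b - A - 1 - a) ?_ ?_ ?_ ?_ ?_ ?_ <;> linarith
  · obtain rfl : a = b + 1 + B := by linarith
    by_cases ha : A ≤ b + 1 + B
    · refine Or.inr (Or.inr (Or.inr (Or.inr (Or.inr (Or.inl ?_)))))
      refine mem_segment_pt 1 1 (2 * B - A + 1) (b + 1 + B - A) ?_ ?_ ?_ ?_ ?_ ?_ <;> linarith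
    · have hb : b ≤ -A - 1 := by
        rcases hv₁ with hv₁ | hv₁ | hv₁ <;> linarith
      refine Or.inr (Or.inr (Or.inr (Or.inl (Or.inr ?_))))
      rw [segment_symm]
      refine mem_segment_pt (-1) (-1) (2 * B - A + 1) (-A - 1 - b) ?_ ?_ ?_ ?_ ?_ ?_ <;> linarith
  · obtain rfl : a = -B - 1 := by linarith
    by_cases hb : b ≤ -A - 1
    · refine Or.inr (Or.inr (Or.inr (Or.inl (Or.inl ?_))))
      refine mem_segment_pt 0 (-1) (2 * B - A + 1) (-A - 1 - b) ?_ ?_ ?_ ?_ ?_ ?_ <;> linarith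
    · have hb' : A - B ≤ b := by
        rcases hv₁ with hv₁ | hv₁ | hv₁ <;> linarith
      refine Or.inr (Or.inl (Or.inr ?_))
      rw [segment_symm]
      refine mem_segment_pt 0 1 (2 * B - A) (b - (A - B)) ?_ ?_ ?_ ?_ ?_ ?_ <;> linarith

theorem isBounded_gauge_le (A B : ℝ) :
    Bornology.IsBounded {v : E | gauge₁ v ≤ A ∨ gauge₂ v ≤ B} := by
  refine isBounded_iff_forall_norm_le.mpr
    ⟨(2 * |A| + 2 * |B| + 2) * ‖α₁‖ + (2 * |A| + 2 * |B| + 2) * ‖α₂‖, fun v hv => ?_⟩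
  obtain ⟨a, b, rfl⟩ := exists_eq_pt v
  rw [mem_ofPred_eq, gauge₁_pt_le_iff, gauge₂_pt_le_iff] at hv
  have hA := le_abs_self A
  have hB := le_abs_self B
  have hA' := abs_nonneg A
  have hB' := abs_nonneg B
  have ha : |a| ≤ 2 * |A| + 2 * |B| + 2 := by
    rw [abs_le]
    rcases hv with ⟨_, _, _⟩ | ⟨_, _, _⟩ <;> constructor <;> linarith
  have hb : |b| ≤ 2 * |A| + 2 * |B| + 2 := by
    rw [abs_le]
    rcases hv with ⟨_, _, _⟩ | ⟨_, _, _⟩ <;> constructor <;> linarith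
  calc ‖pt a b‖ ≤ ‖a • α₁‖ + ‖b • α₂‖ := norm_add_le _ _
    _ = |a| * ‖α₁‖ + |b| * ‖α₂‖ := by rw [norm_smul, norm_smul, Real.norm_eq_abs, Real.norm_eq_abs]
    _ ≤ _ := by gcongr

/-- The star is the union of two closed triangles, and its interior is the union of their
interiors. -/
theorem interior_starPolygon_eq {x : W} {A B : ℝ} (h : cen x = pt A B) (h₁ : 0 < 2 * A - B)
    (h₂ : 0 < 2 * B - A) : interior (starPolygon x) = {v | gauge₁ v < A ∨ gauge₂ v < B} := by
  have hO : IsOpen {v : E | gauge₁ v < A ∨ gauge₂ v < B} :=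
    (isOpen_lt continuous_gauge₁ continuous_const).union
      (isOpen_lt continuous_gauge₂ continuous_const)
  have hOS : {v : E | gauge₁ v < A ∨ gauge₂ v < B} ⊆ {v | gauge₁ v ≤ A ∨ gauge₂ v ≤ B} :=
    fun v hv => hv.imp le_of_lt le_of_lt
  have hS : starPolygon x = {v | gauge₁ v ≤ A ∨ gauge₂ v ≤ B} := by
    refine union_bounded_components_eq (c := origin) (starBoundary_subset h h₁ h₂) hO
      ((isClosed_le continuous_gauge₁ continuous_const).union
        (isClosed_le continuous_gauge₂ continuous_const)) hOS ?_ (isBounded_gauge_le A B) ?_ ?_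
    · rintro v ⟨hv, hv'⟩
      simp only [mem_ofPred_eq, not_or, not_lt] at hv hv'
      rcases hv with hv | hv
      · exact mem_starBoundary_of_gauge₁_eq h h₁ h₂ (le_antisymm hv hv'.1) hv'.2
      · exact mem_starBoundary_of_gauge₂_eq h h₁ h₂ hv'.1 (le_antisymm hv hv'.2)
    · left
      rw [origin, gauge₁_pt_le_iff]
      refine ⟨?_, ?_, ?_⟩ <;> linarith
    · intro v hv s hs
      simp only [mem_ofPred_eq, not_or, not_le] at hv ⊢
      obtain ⟨g₁, g₂⟩ := gauge_ray v hs
      constructor <;> nlinarith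
  rw [hS]
  refine interior_eq_of_ray (c := origin) hO hOS fun v hv s hs => ?_
  simp only [mem_ofPred_eq, not_or, not_le, not_lt] at hv ⊢
  obtain ⟨g₁, g₂⟩ := gauge_ray v hs.le
  constructor <;> nlinarith

theorem gauge_ofLattice (p : ℤ × ℤ) :
    gauge₁ (ofLattice p) = height₁ p / 9 ∧ gauge₂ (ofLattice p) = height₂ p / 9 := by
  have h9 : (0 : ℝ) ≤ 9 := by norm_num
  constructor
  · simp only [gauge₁, ofLattice, coord₁_pt, coord₂_pt, height₁]
    push_cast
    rw [← max_div_div_right h9, ← max_div_div_right h9]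
    congr 1; congr 1 <;> ring
  · simp only [gauge₂, ofLattice, coord₁_pt, coord₂_pt, height₂]
    push_cast
    rw [← max_div_div_right h9, ← max_div_div_right h9]
    congr 1; congr 1 <;> ring

end AffineA2

theorem mainTheorem4 (x : AffineA2.W) (hx : AffineA2.IsDominant x) :
    AffineA2.upperSet x = {z : AffineA2.W | AffineA2.cen z ∉ interior (AffineA2.starPolygon x)} := by
  open AffineA2 in
  obtain ⟨h₁, h₂⟩ := center_pos_of_isDominant hx
  have e₁ : (0 : ℝ) < (center x).1 := by exact_mod_cast h₁
  have e₂ : (0 : ℝ) < (center x).2 := by exact_mod_cast h₂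
  -- At a dominant center both maxima are attained at the fundamental weights themselves, so these
  -- heights are nine times the coordinates of cen(x).
  have hA : height₁ (center x) = 2 * (center x).1 + (center x).2 := by
    simp only [height₁]; omega
  have hB : height₂ (center x) = (center x).1 + 2 * (center x).2 := by
    simp only [height₂]; omega
  ext z
  change BruhatLE x z ↔ cen z ∉ interior (starPolygon x)
  rw [bruhatLE_iff h₁ h₂, hA, hB, interior_starPolygon_eq (cen_eq_ofLattice x) (by linarith)
    (by linarith), cen_eq_ofLattice z, Set.mem_ofPred_eq, (gauge_ofLattice _).1,
    (gauge_ofLattice _).2, not_or, not_lt, not_lt, div_le_div_iff_of_pos_right (by norm_num),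
    div_le_div_iff_of_pos_right (by norm_num)]
  norm_cast
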